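/- **Setting.** Terms of the linear substitution calculus (LSC), over a countable set $\mathcal V$ of variables and up to $\alpha$-conversion, are $$t,u ::= x \mid \lambda x.t \mid t\,u \mid t[x{\leftarrow}u],$$ where $\lambda x.t$ binds $x$ in $t$, and the explicit substitution $t[x{\leftarrow}u]$ binds $x$ in $t$ but not in $u$. A context is a term with exactly one hole $\langle\cdot\rangle$; $C\langle t\rangle$ and $C\langle D\rangle$ denote (possibly capturing) plugging. The level of a context is the number of arguments and of contents $u$ of explicit substitutions $[x{\leftarrow}u]$ that contain the hole; $C_n$ denotes a context of level $n$. Head contexts $H$ are the contexts of level $0$; substitution contexts are $S ::= \langle\cdot\rangle \mid S[x{\leftarrow}t]$. *Linear head evaluation* $\multimap$ is the closure by head contexts of the rules $$S\langle\lambda x.t\rangle u\mapsto S\langle t[x{\leftarrow}u]\rangle,\qquad H\langle x\rangle[x{\leftarrow}t]\mapsto H\langle t\rangle[x{\leftarrow}t],\qquad t[x{\leftarrow}u]\mapsto t\ \text{ if } x\notin \mathrm{fv}(t),$$ where $H$ does not capture the displayed $x$, and bound variables are renamed so that no free variable of $u$ (first rule) or $t$ (second rule) is captured. A term $t$ is *$\multimap$-divergent*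 if there is an infinite sequence $t=t_0\multimap t_1\multimap t_2\multimap\cdots$. *The $\lambda$-IAM.* Logged positions are triples $\ell=(t,C_n,L_n)$, where $L_n$ is a log, that is, a finite list of logged positions, of length $n$. A tape $T$ is a finite list of logged positions and symbols $\mathsf p$. A state $(t,C,L,T,d)$ consists of a term, a context, a log, a tape and a direction $d\in\{\downarrow,\uparrow\}$. The transitions are as follows; states are written $\downarrow(t,C,T,L)$ or $\uparrow(t,C,T,L)$, and in the rules about a variable $x$ the displayed binder is the one that binds the displayed occurrence of $x$. $$\begin{array}{rcl} \downarrow(tu,\,C,\,T,\,L)&\to&\downarrow(t,\,C\langle\langle\cdot\rangle u\rangle,\,\mathsf p\cdot T,\,L)\\ \downarrow(\lambda x.t,\,C,\,\mathsf p\cdot T,\,L)&\to&\downarrow(t,\,C\langle\lambda x.\langle\cdot\rangle\rangle,\,T,\,L)\\ \downarrow(x,\,C\langle\lambda x.D_n\rangle,\,T,\,L_n\cdot L)&\to&\uparrow(\lambda x.D_n\langle x\rangle,\,C,\,(x,\lambda x.D_n,L_n)\cdot T,\,L)\\ \downarrow(\lambda x.D_n\langle x\rangle,\,C,\,(x,\lambda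 x.D_n,L_n)\cdot T,\,L)&\to&\uparrow(x,\,C\langle\lambda x.D_n\rangle,\,T,\,L_n\cdot L)\\ \downarrow(t[x{\leftarrow}u],\,C,\,T,\,L)&\to&\downarrow(t,\,C\langle\langle\cdot\rangle[x{\leftarrow}u]\rangle,\,T,\,L)\\ \downarrow(x,\,C\langle D_n[x{\leftarrow}u]\rangle,\,T,\,L_n\cdot L)&\to&\downarrow(u,\,C\langle D_n\langle x\rangle[x{\leftarrow}\langle\cdot\rangle]\rangle,\,T,\,(x,D_n[x{\leftarrow}u],L_n)\cdot L)\\ \uparrow(t,\,C\langle\langle\cdot\rangle u\rangle,\,\mathsf p\cdot T,\,L)&\to&\uparrow(tu,\,C,\,T,\,L)\\ \uparrow(t,\,C\langle\lambda x.\langle\cdot\rangle\rangle,\,T,\,L)&\to&\uparrow(\lambda x.t,\,C,\,\mathsf p\cdot T,\,L)\\ \uparrow(t,\,C\langle\langle\cdot\rangle u\rangle,\,\ell\cdot T,\,L)&\to&\downarrow(u,\,C\langle t\langle\cdot\rangle\rangle,\,T,\,\ell\cdot L)\\ \uparrow(u,\,C\langle t\langle\cdot\rangle\rangle,\,T,\,\ell\cdot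 L)&\to&\downarrow(t,\,C\langle\langle\cdot\rangle u\rangle,\,\ell\cdot T,\,L)\\ \uparrow(t,\,C\langle\langle\cdot\rangle[x{\leftarrow}u]\rangle,\,T,\,L)&\to&\uparrow(t[x{\leftarrow}u],\,C,\,T,\,L)\\ \uparrow(u,\,C\langle D_n\langle x\rangle[x{\leftarrow}\langle\cdot\rangle]\rangle,\,T,\,(x,D_n[x{\leftarrow}u],L_n)\cdot L)&\to&\uparrow(x,\,C\langle D_n[x{\leftarrow}u]\rangle,\,T,\,L_n\cdot L) \end{array}$$ *Semantics.* For a term $t$ and a depth $k\ge 0$, run the machine from $\downarrow(t,\langle\cdot\rangle,\mathsf p^k,\epsilon)$. Then $\llbracket t\rrbracket_k$ is - the bound success $\langle h,j\rangle$ if the run reaches $\uparrow(t,\langle\cdot\rangle,\mathsf p^h\cdot\ell\cdot\mathsf p^j,\epsilon)$ for some logged position $\ell$; - the open success $\langle x,h\rangle$ if it reaches $\downarrow(x,C,\mathsf p^h,L)$ for some $C,L$, where $x$ is a free variable of the code $C\langle x\rangle$ (not bound by $C$); - the failure $\Downarrow$ if it reaches $\downarrow(\lambda x.u,C,\epsilon,L)$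 for some $u,C,L$; - $\bot$ otherwise. **Proposition ($\multimap$-divergence implies that the $\lambda$-IAM never succeeds).** Let $t$ be a $\multimap$-divergent LSC term. Then there is no $k\ge 0$ such that $\llbracket t\rrbracket_k$ is a (bound or open) success. -/

import Mathlib

namespace LSC

/-- Terms of the linear substitution calculus up to α-conversion, in de Bruijn notation.
`lam t` binds index `0` in `t`; `es t u` is the explicit substitution `t[x←u]`, which binds
index `0` in `t` and binds nothing in `u`. Free variables are the natural numbers. -/
inductive Term : Type
  | var (i : ℕ)
  | lam (t : Term)
  | app (t u : Term)
  | es (t u : Term)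

/-- Add `d` to every index of `t` that is at least `c` (renaming that avoids capture). -/
def Term.shift (d : ℕ) : ℕ → Term → Term
  | c, .var i => .var (if i < c then i else i + d)
  | c, .lam t => .lam (t.shift d (c + 1))
  | c, .app t u => .app (t.shift d c) (u.shift d c)
  | c, .es t u => .es (t.shift d (c + 1)) (u.shift d c)

/-- Contexts: terms with exactly one hole. -/
inductive Ctx : Type
  | hole
  /-- `λx.C` -/
  | lam (C : Ctx)
  /-- `C t` -/
  | appL (C : Ctx) (t : Term)
  /-- `t C` -/
  | appR (t : Term) (C : Ctx)
  /-- `C[x←t]` -/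
  | esL (C : Ctx) (t : Term)
  /-- `t[x←C]` -/
  | esR (t : Term) (C : Ctx)

namespace Ctx

/-- The level: the number of arguments and of contents of explicit substitutions
that contain the hole. -/
def level : Ctx → ℕ
  | hole => 0
  | lam C => C.level
  | appL C _ => C.level
  | appR _ C => C.level + 1
  | esL C _ => C.level
  | esR _ C => C.level + 1

/-- The number of binders of the context whose scope contains the hole. -/
def depth : Ctx → ℕ
  | hole => 0
  | lam C => C.depth + 1
  | appL C _ => C.depth
  | appR _ C => C.depth
  | esL C _ => C.depth + 1
  | esR _ C => C.depth

/-- Plugging `C⟨t⟩`, which may capture free variables of `t`. -/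
def plug : Ctx → Term → Term
  | hole, s => s
  | lam C, s => .lam (C.plug s)
  | appL C t, s => .app (C.plug s) t
  | appR t C, s => .app t (C.plug s)
  | esL C t, s => .es (C.plug s) t
  | esR t C, s => .es t (C.plug s)

/-- Plugging `C⟨D⟩` of a context in a context. -/
def comp : Ctx → Ctx → Ctx
  | hole, D => D
  | lam C, D => lam (C.comp D)
  | appL C t, D => appL (C.comp D) t
  | appR t C, D => appR t (C.comp D)
  | esL C t, D => esL (C.comp D) t
  | esR t C, D => esR t (C.comp D)

/-- Head contexts are the contexts of level `0`. -/
def IsHead (C : Ctx) : Prop := C.level = 0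

/-- Substitution contexts `S ::= ⟨·⟩ | S[x←t]`. -/
def IsSubst : Ctx → Prop
  | hole => True
  | esL S _ => S.IsSubst
  | _ => False

end Ctx

/-! ### Linear head evaluation -/

/-- The three rewriting rules at top level. -/
inductive Root : Term → Term → Prop
  /-- `S⟨λx.t⟩ u ↦ S⟨t[x←u]⟩`, where `u` is renamed so that `S` does not capture it. -/
  | dB (S : Ctx) (hS : S.IsSubst) (t u : Term) :
      Root (.app (S.plug (.lam t)) u) (S.plug (.es t (u.shift S.depth 0)))
  /-- `H⟨x⟩[x←t] ↦ H⟨t⟩[x←t]`, for an occurrence of `x` that `H` does not capture, and where `t`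
  is renamed so that neither `H` nor the explicit substitution captures it. -/
  | ls (H : Ctx) (hH : H.IsHead) (t : Term) :
      Root (.es (H.plug (.var H.depth)) t) (.es (H.plug (t.shift (H.depth + 1) 0)) t)
  /-- `t[x←u] ↦ t` if `x` is not free in `t`: the body is `t` moved under a binder that
  it does not use. -/
  | gc (t u : Term) : Root (.es (t.shift 1 0) u) t

/-- Linear head evaluation `⊸`: the closure of the top-level rules by head contexts. -/
inductive LHE : Term → Term → Prop
  | ctx (H : Ctx) (hH : H.IsHead) {t u : Term} (h : Root t u) : LHE (H.plug t) (H.plug u)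

/-- `t` is `⊸`-divergent: some infinite `⊸`-reduction sequence starts from `t`. -/
def Divergent (t : Term) : Prop :=
  ∃ f : ℕ → Term, f 0 = t ∧ ∀ i, LHE (f i) (f (i + 1))

/-! ### The λ-IAM -/

/-- Logged positions `(t, Cₙ, Lₙ)`, where the log `Lₙ` has as many entries as the level of `Cₙ`. -/
inductive LPos : Type
  | mk (t : Term) (C : Ctx) (L : Fin C.level → LPos)

/-- The entries of a tape: the symbol `p` and logged positions. -/
inductive TapeSym : Type
  | p
  | pos (l : LPos)

inductive Dir : Type
  | down
  | up

structure State : Type where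
  term : Term
  ctx : Ctx
  log : List LPos
  tape : List TapeSym
  dir : Dir

open TapeSym Dir

/-- The logged position `(x, λx.Dₙ, Lₙ)` of an occurrence of `x` relative to its abstraction. -/
def lamPos (D : Ctx) (Ln : Fin D.level → LPos) : LPos := .mk (.var D.depth) (.lam D) Ln

/-- The logged position `(x, Dₙ[x←u], Lₙ)` of an occurrence of `x` relative to its explicit
substitution. -/
def esPos (D : Ctx) (u : Term) (Ln : Fin D.level → LPos) : LPos := .mk (.var D.depth) (.esL D u) Ln

/-- The transitions of the λ-IAM; the fields of a state are, in this order, the code term, the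
code context, the log, the tape and the direction. An occurrence of `x` in the hole of
`C⟨λx.D⟩` or `C⟨D[x←u]⟩` has index `D.depth`. -/
inductive Step : State → State → Prop
  | app (t u C L T) :
      Step ⟨.app t u, C, L, T, down⟩ ⟨t, C.comp (.appL .hole u), L, p :: T, down⟩
  | lam (t C L T) :
      Step ⟨.lam t, C, L, p :: T, down⟩ ⟨t, C.comp (.lam .hole), L, T, down⟩
  | var (C : Ctx) (D : Ctx) (Ln : Fin D.level → LPos) (L T) :
      Step ⟨.var D.depth, C.comp (.lam D), List.ofFn Ln ++ L, T, down⟩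
        ⟨.lam (D.plug (.var D.depth)), C, L, pos (lamPos D Ln) :: T, up⟩
  | bt2 (C : Ctx) (D : Ctx) (Ln : Fin D.level → LPos) (L T) :
      Step ⟨.lam (D.plug (.var D.depth)), C, L, pos (lamPos D Ln) :: T, down⟩
        ⟨.var D.depth, C.comp (.lam D), List.ofFn Ln ++ L, T, up⟩
  | es (t u C L T) :
      Step ⟨.es t u, C, L, T, down⟩ ⟨t, C.comp (.esL .hole u), L, T, down⟩
  | var2 (C : Ctx) (D : Ctx) (u : Term) (Ln : Fin D.level → LPos) (L T) :
      Step ⟨.var D.depth, C.comp (.esL D u), List.ofFn Ln ++ L, T, down⟩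
        ⟨u, C.comp (.esR (D.plug (.var D.depth)) .hole), esPos D u Ln :: L, T, down⟩
  | appUp (t u : Term) (C : Ctx) (L T) :
      Step ⟨t, C.comp (.appL .hole u), L, p :: T, up⟩ ⟨.app t u, C, L, T, up⟩
  | lamUp (t : Term) (C : Ctx) (L T) :
      Step ⟨t, C.comp (.lam .hole), L, T, up⟩ ⟨.lam t, C, L, p :: T, up⟩
  | arg (t u : Term) (C : Ctx) (l : LPos) (L T) :
      Step ⟨t, C.comp (.appL .hole u), L, pos l :: T, up⟩
        ⟨u, C.comp (.appR t .hole), l :: L, T, down⟩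
  | bt1 (t u : Term) (C : Ctx) (l : LPos) (L T) :
      Step ⟨u, C.comp (.appR t .hole), l :: L, T, up⟩
        ⟨t, C.comp (.appL .hole u), L, pos l :: T, down⟩
  | esUp (t u : Term) (C : Ctx) (L T) :
      Step ⟨t, C.comp (.esL .hole u), L, T, up⟩ ⟨.es t u, C, L, T, up⟩
  | var3 (C : Ctx) (D : Ctx) (u : Term) (Ln : Fin D.level → LPos) (L T) :
      Step ⟨u, C.comp (.esR (D.plug (.var D.depth)) .hole), esPos D u Ln :: L, T, up⟩
        ⟨.var D.depth, C.comp (.esL D u), List.ofFn Ln ++ L, T, up⟩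

/-- The initial state of code `t` and depth `k`. -/
def initState (t : Term) (k : ℕ) : State := ⟨t, .hole, [], List.replicate k p, down⟩

/-- Reachability by a run, that is, by a possibly empty sequence of transitions. -/
def Reaches : State → State → Prop := Relation.ReflTransGen Step

/-- The possible values of the semantics. -/
inductive Outcome : Type
  /-- the bound success `⟨h, j⟩` -/
  | bound (h j : ℕ)
  /-- the open success `⟨x, h⟩`, where `x` is a free variable of the code -/
  | openVar (x h : ℕ)
  /-- `⇓` -/
  | fail
  /-- `⊥` -/
  | bot

/-- `t` yields `o` at depth `k`: the clauses that define the semantics. In the second one the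
variable is the free variable `x` of the code, which has index `x + C.depth` below the
binders of `C`. -/
def Yields (t : Term) (k : ℕ) : Outcome → Prop
  | .bound h j => ∃ l : LPos, Reaches (initState t k)
      ⟨t, .hole, [], List.replicate h p ++ pos l :: List.replicate j p, up⟩
  | .openVar x h => ∃ (C : Ctx) (L : List LPos), Reaches (initState t k)
      ⟨.var (x + C.depth), C, L, List.replicate h p, down⟩
  | .fail => ∃ (u : Term) (C : Ctx) (L : List LPos), Reaches (initState t k)
      ⟨.lam u, C, L, [], down⟩
  | .bot => (¬ ∃ (h j : ℕ) (l : LPos), Reaches (initState t k)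
      ⟨t, .hole, [], List.replicate h p ++ pos l :: List.replicate j p, up⟩) ∧
      (¬ ∃ (x h : ℕ) (C : Ctx) (L : List LPos), Reaches (initState t k)
        ⟨.var (x + C.depth), C, L, List.replicate h p, down⟩) ∧
      ¬ ∃ (u : Term) (C : Ctx) (L : List LPos), Reaches (initState t k) ⟨.lam u, C, L, [], down⟩

theorem exists_yields (t : Term) (k : ℕ) : ∃ o, Yields t k o := by
  by_cases h1 : ∃ (h j : ℕ) (l : LPos), Reaches (initState t k)
      ⟨t, .hole, [], List.replicate h p ++ pos l :: List.replicate j p, up⟩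
  · obtain ⟨h, j, l, hl⟩ := h1
    exact ⟨.bound h j, l, hl⟩
  by_cases h2 : ∃ (x h : ℕ) (C : Ctx) (L : List LPos), Reaches (initState t k)
        ⟨.var (x + C.depth), C, L, List.replicate h p, down⟩
  · obtain ⟨x, h, C, L, hl⟩ := h2
    exact ⟨.openVar x h, C, L, hl⟩
  by_cases h3 : ∃ (u : Term) (C : Ctx) (L : List LPos), Reaches (initState t k)
      ⟨.lam u, C, L, [], down⟩
  · exact ⟨.fail, h3⟩
  exact ⟨.bot, h1, h2, h3⟩

/-- The semantics `⟦t⟧ₖ`: the outcome that `t` yields at depth `k`. -/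
noncomputable def sem (t : Term) (k : ℕ) : Outcome := Classical.choose (exists_yields t k)

/-- Bound and open successes. -/
def Outcome.IsSuccess : Outcome → Prop
  | .bound _ _ => True
  | .openVar _ _ => True
  | .fail => False
  | .bot => False

/-! ### Determinism, and uniqueness of the outcome -/

theorem Ctx.depth_comp (C D : Ctx) : (C.comp D).depth = C.depth + D.depth := by
  induction C <;> simp [Ctx.comp, Ctx.depth, *] <;> omega

/-- A single constructor around the hole. -/
def Ctx.IsFrame : Ctx → Prop
  | .hole => False
  | .lam C => C = .hole
  | .appL C _ => C = .hole
  | .appR _ C => C = .hole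
  | .esL C _ => C = .hole
  | .esR _ C => C = .hole

theorem Ctx.comp_eq_hole {C X : Ctx} (h : C.comp X = .hole) : X = .hole := by
  cases C <;> simp_all [Ctx.comp]

theorem Ctx.frame_inj {C C' X Y : Ctx} (hX : X.IsFrame) (hY : Y.IsFrame)
    (h : C.comp X = C'.comp Y) : C = C' ∧ X = Y := by
  induction C generalizing C' with
  | hole =>
    cases C' <;> simp only [Ctx.comp] at h
    · exact ⟨rfl, h⟩
    all_goals
      subst h
      have h0 := Ctx.comp_eq_hole hX
      subst h0
      exact hY.elim
  | _ =>
    cases C' <;> simp only [Ctx.comp] at h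
    case hole =>
      subst h
      have h0 := Ctx.comp_eq_hole hY
      subst h0
      exact hX.elim
    all_goals simp_all
    all_goals grind

/-- The outermost constructor binds a variable in the part that contains the hole. -/
def Ctx.IsBinder : Ctx → Prop
  | .lam _ => True
  | .esL _ _ => True
  | _ => False

theorem Ctx.binder_inj {C C' X Y : Ctx} (hX : X.IsBinder) (hY : Y.IsBinder)
    (hd : X.depth = Y.depth) (h : C.comp X = C'.comp Y) : C = C' ∧ X = Y := by
  induction C generalizing C' with
  | hole =>
    cases C' <;> simp only [Ctx.comp] at h
    · exact ⟨rfl, h⟩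
    all_goals
      subst h
      simp [Ctx.depth, Ctx.depth_comp, Ctx.IsBinder] at hd hX
      try omega
  | _ =>
    cases C' <;> simp only [Ctx.comp] at h
    case hole =>
      subst h
      simp [Ctx.depth, Ctx.depth_comp, Ctx.IsBinder] at hd hY
      try omega
    all_goals simp_all
    all_goals grind

theorem lpos_inj {t t' : Term} {C C' : Ctx} {L : Fin C.level → LPos} {L' : Fin C'.level → LPos}
    (h : LPos.mk t C L = LPos.mk t' C' L') : C = C' ∧ List.ofFn L = List.ofFn L' := by
  injection h with h1 h2 h3
  subst h2
  exact ⟨rfl, by rw [eq_of_heq h3]⟩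

theorem lamPos_inj {D D' : Ctx} {L : Fin D.level → LPos} {L' : Fin D'.level → LPos}
    (h : lamPos D L = lamPos D' L') : D = D' ∧ List.ofFn L = List.ofFn L' := by
  obtain ⟨h1, h2⟩ := lpos_inj h
  exact ⟨Ctx.lam.inj h1, h2⟩

theorem esPos_inj {D D' : Ctx} {u u' : Term} {L : Fin D.level → LPos} {L' : Fin D'.level → LPos}
    (h : esPos D u L = esPos D' u' L') : D = D' ∧ u = u' ∧ List.ofFn L = List.ofFn L' := by
  obtain ⟨h1, h2⟩ := lpos_inj h
  exact ⟨(Ctx.esL.inj h1).1, (Ctx.esL.inj h1).2, h2⟩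

theorem ofFn_append_inj {D D' : Ctx} {L : Fin D.level → LPos} {L' : Fin D'.level → LPos}
    {M M' : List LPos} (hD : D = D') (h : List.ofFn L ++ M = List.ofFn L' ++ M') :
    HEq L L' ∧ M = M' := by
  subst hD
  obtain ⟨h1, h2⟩ := List.append_inj h (by simp)
  exact ⟨heq_of_eq (List.ofFn_injective h1), h2⟩

theorem Step.deterministic {s a b : State} (h1 : Step s a) (h2 : Step s b) : a = b := by
  suffices H : ∀ s', Step s' b → s = s' → a = b from H s h2 rfl
  clear h2
  intro s' h2 e
  cases h1 <;> cases h2 <;> simp only [State.mk.injEq, reduceCtorEq, false_and, and_false,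
    List.cons.injEq, TapeSym.pos.injEq, Term.var.injEq, Term.lam.injEq, Term.app.injEq,
    Term.es.injEq, true_and, and_true] at e
  case app.app => simp_all
  case lam.lam => simp_all
  case es.es => simp_all
  case bt2.bt2 =>
    obtain ⟨-, rfl, rfl, h3, rfl⟩ := e
    obtain ⟨rfl, h⟩ := lamPos_inj h3
    rw [h]
  case' var.var | var.var2 | var2.var | var2.var2 =>
    have h := Ctx.binder_inj (by simp [Ctx.IsBinder]) (by simp [Ctx.IsBinder])
      (by simpa [Ctx.depth] using e.1) e.2.1
    obtain ⟨hC, hX⟩ := h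
    simp only [Ctx.lam.injEq, Ctx.esL.injEq, reduceCtorEq] at hX
  case var.var | var2.var2 =>
    obtain ⟨-, -, hL, rfl⟩ := e
    obtain ⟨h5, rfl⟩ := ofFn_append_inj (by simp_all) hL
    obtain ⟨rfl, rfl⟩ := hX
    subst hC
    cases h5
    rfl
  all_goals
    have h := Ctx.frame_inj (by simp [Ctx.IsFrame]) (by simp [Ctx.IsFrame]) e.2.1
    try simp only [reduceCtorEq, and_false] at h
  case var3.var3 =>
    obtain ⟨-, -, ⟨h3, rfl⟩, rfl⟩ := e
    obtain ⟨rfl, rfl, hl⟩ := esPos_inj h3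
    simp_all
  all_goals simp_all

/-- A state from which no transition is possible. -/
def State.Final (s : State) : Prop := ∀ s', ¬ Step s s'

theorem Reaches.final_unique {s a b : State} (h1 : Reaches s a) (h2 : Reaches s b)
    (ha : a.Final) (hb : b.Final) : a = b := by
  induction h1 using Relation.ReflTransGen.head_induction_on with
  | refl =>
    rcases Relation.ReflTransGen.cases_head h2 with h | ⟨c, h, -⟩
    · exact h
    · exact (ha _ h).elim
  | head h _ ih =>
    rcases Relation.ReflTransGen.cases_head h2 with rfl | ⟨c, h', h2⟩
    · exact (hb _ h).elim
    · exact ih (Step.deterministic h' h ▸ h2)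

theorem final_bound (t : Term) (L : List LPos) (T : List TapeSym) :
    State.Final ⟨t, .hole, L, T, up⟩ := by
  intro s' h
  generalize hs : (⟨t, .hole, L, T, up⟩ : State) = s at h
  cases h <;> simp only [State.mk.injEq, reduceCtorEq, and_false] at hs <;>
    exact absurd (Ctx.comp_eq_hole hs.2.1.symm) (by simp)

theorem final_openVar (x : ℕ) (C : Ctx) (L : List LPos) (T : List TapeSym) :
    State.Final ⟨.var (x + C.depth), C, L, T, down⟩ := by
  intro s' h
  generalize hs : (⟨.var (x + C.depth), C, L, T, down⟩ : State) = s at h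
  cases h <;> simp only [State.mk.injEq, reduceCtorEq, and_false, false_and] at hs
  all_goals
    obtain ⟨h1, rfl, -⟩ := hs
    simp [Ctx.depth_comp, Ctx.depth] at h1
    omega

theorem final_fail (u : Term) (C : Ctx) (L : List LPos) :
    State.Final ⟨.lam u, C, L, [], down⟩ := by
  intro s' h
  cases h

theorem replicate_pos_inj {h h' : ℕ} {l l' : LPos} {T T' : List TapeSym}
    (e : List.replicate h p ++ pos l :: T = List.replicate h' p ++ pos l' :: T') :
    h = h' ∧ T = T' := by
  induction h generalizing h' with
  | zero => cases h' <;> simp_all [List.replicate_succ]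
  | succ n ih =>
    cases h' with
    | zero => simp [List.replicate_succ] at e
    | succ m =>
      simp only [List.replicate_succ, List.cons_append, List.cons.injEq, true_and] at e
      simpa using ih e

theorem yields_unique {t : Term} {k : ℕ} {o o' : Outcome} (h : Yields t k o)
    (h' : Yields t k o') : o = o' := by
  cases o <;> cases o' <;> simp only [Yields] at h h'
  case bound.bound =>
    obtain ⟨l, h⟩ := h
    obtain ⟨l', h'⟩ := h'
    have e := Reaches.final_unique h h' (final_bound _ _ _) (final_bound _ _ _)
    simp only [State.mk.injEq, true_and, and_true] at e
    have e' := replicate_pos_inj e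
    have e2 := congrArg List.length e'.2
    simp_all
  case openVar.openVar =>
    obtain ⟨C, L, h⟩ := h
    obtain ⟨C', L', h'⟩ := h'
    have e := Reaches.final_unique h h' (final_openVar _ _ _ _) (final_openVar _ _ _ _)
    simp only [State.mk.injEq, Term.var.injEq, and_true] at e
    obtain ⟨e1, rfl, -, e3⟩ := e
    have e2 := congrArg List.length e3
    simp at e1 e2
    rw [e1, e2]
  case bound.openVar =>
    obtain ⟨l, h⟩ := h
    obtain ⟨C, L, h'⟩ := h'
    have e := Reaches.final_unique h h' (final_bound _ _ _) (final_openVar _ _ _ _)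
    simp at e
  case openVar.bound =>
    obtain ⟨C, L, h⟩ := h
    obtain ⟨l, h'⟩ := h'
    have e := Reaches.final_unique h h' (final_openVar _ _ _ _) (final_bound _ _ _)
    simp at e
  case bound.fail =>
    obtain ⟨l, h⟩ := h
    obtain ⟨u, C, L, h'⟩ := h'
    have e := Reaches.final_unique h h' (final_bound _ _ _) (final_fail _ _ _)
    simp at e
  case fail.bound =>
    obtain ⟨u, C, L, h⟩ := h
    obtain ⟨l, h'⟩ := h'
    have e := Reaches.final_unique h h' (final_fail _ _ _) (final_bound _ _ _)
    simp at e
  case openVar.fail =>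
    obtain ⟨C, L, h⟩ := h
    obtain ⟨u, C', L', h'⟩ := h'
    have e := Reaches.final_unique h h' (final_openVar _ _ _ _) (final_fail _ _ _)
    simp at e
  case fail.openVar =>
    obtain ⟨u, C, L, h⟩ := h
    obtain ⟨C', L', h'⟩ := h'
    have e := Reaches.final_unique h h' (final_fail _ _ _) (final_openVar _ _ _ _)
    simp at e
  case bot.bound =>
    obtain ⟨l, h'⟩ := h'
    exact (h.1 ⟨_, _, l, h'⟩).elim
  case bound.bot =>
    obtain ⟨l, h⟩ := h
    exact (h'.1 ⟨_, _, l, h⟩).elim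
  case bot.openVar =>
    obtain ⟨C, L, h'⟩ := h'
    exact (h.2.1 ⟨_, _, C, L, h'⟩).elim
  case openVar.bot =>
    obtain ⟨C, L, h⟩ := h
    exact (h'.2.1 ⟨_, _, C, L, h⟩).elim
  case bot.fail => exact (h.2.2 h').elim
  case fail.bot => exact (h'.2.2 h).elim
  all_goals rfl

theorem sem_eq_iff {t : Term} {k : ℕ} {o : Outcome} : sem t k = o ↔ Yields t k o :=
  ⟨fun h => h ▸ Classical.choose_spec (exists_yields t k),
    fun h => yields_unique (Classical.choose_spec (exists_yields t k)) h⟩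

end LSC

namespace LSC

open TapeSym Dir

/-! ### An environment machine for linear head evaluation -/

/-! The λ-IAM and linear head evaluation are compared through a third device, a Krivine-style
environment machine whose terminating runs carry their length.

On one side, every linear head step strictly shortens such a run (`LHE.halts_lt`): turning a β-redex
into an explicit substitution saves the application transition, replacing a variable by its content
saves the lookup, and garbage collection saves the creation of an environment entry. Lengths are
natural numbers, so a divergent term has no terminating run (`Divergent.not_halts`).

On the other side, a success is a final λ-IAM state that is not a failure, and reaching one makes
the environment machine stop (`Models.exists_halts`). Each of its transitions is matched by at least
one λ-IAM step between downward states with as many symbols `p` on the tape as there are stack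
entries. The λ-IAM has no environment: it recovers an argument by sending a logged position upwards.
Reversibility (`Step.flip`) lets such a query, issued inside the code reached by a variable, first
retrace the path back to that variable. Determinism and finality make the λ-IAM run well-founded,
hence also the run it follows. The initial symbols `p` play the role of dummy arguments. -/

/-- Closures of the environment machine, together with a dummy argument. -/
inductive Clos : Type
  | mk (u : Term) (e : List Clos)
  | dummy

/-- `Halts n t e π`: the environment machine run on the code `t`, the environment `e` and the stack
`π` stops after `n` transitions on a variable that is free or bound to a dummy argument. -/
inductive Halts : ℕ → Term → List Clos → List Clos → Prop
  | free {i e π} (h : e[i]? = none) : Halts 0 (.var i) e π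
  | dummy {i e π} (h : e[i]? = some .dummy) : Halts 0 (.var i) e π
  | var {n i e π u e'} (h : e[i]? = some (.mk u e')) (hu : Halts n u e' π) :
      Halts (n + 1) (.var i) e π
  | lam {n t e c π} (h : Halts n t (c :: e) π) : Halts (n + 1) (.lam t) e (c :: π)
  | app {n t u e π} (h : Halts n t e (.mk u e :: π)) : Halts (n + 1) (.app t u) e π
  | es {n t u e π} (h : Halts n t (.mk u e :: e) π) : Halts (n + 1) (.es t u) e π

/-! ### Renamings -/

/-- Extend a renaming under a binder. -/
def liftRen (ρ : ℕ → ℕ) : ℕ → ℕ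
  | 0 => 0
  | i + 1 => ρ i + 1

def Term.rename : (ℕ → ℕ) → Term → Term
  | ρ, .var i => .var (ρ i)
  | ρ, .lam t => .lam (t.rename (liftRen ρ))
  | ρ, .app t u => .app (t.rename ρ) (u.rename ρ)
  | ρ, .es t u => .es (t.rename (liftRen ρ)) (u.rename ρ)

theorem liftRen_id : liftRen id = id := by
  funext i; cases i <;> rfl

theorem Term.rename_id (t : Term) : t.rename id = t := by
  induction t <;> simp_all [Term.rename, liftRen_id]

theorem Term.shift_eq_rename (d c : ℕ) (t : Term) :
    t.shift d c = t.rename (fun i => if i < c then i else i + d) := by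
  have key : ∀ c, liftRen (fun i => if i < c then i else i + d) =
      fun i => if i < c + 1 then i else i + d := by
    intro c
    funext i
    cases i with
    | zero => simp [liftRen]
    | succ i => simp only [liftRen]; split_ifs <;> omega
  induction t generalizing c <;> simp_all [Term.shift, Term.rename]

theorem Term.shift_zero_eq_rename (d : ℕ) (t : Term) : t.shift d 0 = t.rename (· + d) := by
  simp [Term.shift_eq_rename]

/-- Equivalence of closures up to a renaming of their codes. -/
inductive Clos.Ren : Clos → Clos → Prop
  | refl (c : Clos) : Clos.Ren c c
  | mk (ρ : ℕ → ℕ) (u : Term) (e e' : List Clos)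
      (h0 : ∀ i, e[i]? = none ↔ e'[ρ i]? = none)
      (h1 : ∀ i c c', e[i]? = some c → e'[ρ i]? = some c' → Clos.Ren c c') :
      Clos.Ren (.mk u e) (.mk (u.rename ρ) e')

/-- The environments `e` and `e'` agree along the renaming `ρ`. -/
structure EnvRen (ρ : ℕ → ℕ) (e e' : List Clos) : Prop where
  none_iff : ∀ i, e[i]? = none ↔ e'[ρ i]? = none
  some_ren : ∀ i c c', e[i]? = some c → e'[ρ i]? = some c' → Clos.Ren c c'

theorem EnvRen.refl (e : List Clos) : EnvRen id e e :=
  ⟨fun _ => Iff.rfl, fun i c c' h h' => by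
    obtain rfl : c = c' := by simpa [h] using h'
    exact .refl c⟩

theorem EnvRen.append (e₁ e : List Clos) : EnvRen (· + e₁.length) e (e₁ ++ e) := by
  have h : ∀ i, (e₁ ++ e)[i + e₁.length]? = e[i]? := fun i => by
    rw [List.getElem?_append_right (by omega), Nat.add_sub_cancel]
  refine ⟨fun i => by rw [h], fun i c c' hc hc' => ?_⟩
  rw [h, hc] at hc'
  cases hc'
  exact .refl c

theorem EnvRen.cons {ρ : ℕ → ℕ} {e e' : List Clos} (h : EnvRen ρ e e') {c c' : Clos}
    (hc : Clos.Ren c c') : EnvRen (liftRen ρ) (c :: e) (c' :: e') := by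
  constructor
  · intro i
    cases i with
    | zero => simp [liftRen]
    | succ i => simpa [liftRen] using h.none_iff i
  · intro i a a' ha ha'
    cases i with
    | zero => simp [liftRen] at ha ha'; subst ha ha'; exact hc
    | succ i => exact h.some_ren i a a' (by simpa using ha) (by simpa [liftRen] using ha')

theorem EnvRen.clos {ρ : ℕ → ℕ} {e e' : List Clos} (h : EnvRen ρ e e') (u : Term) :
    Clos.Ren (.mk u e) (.mk (u.rename ρ) e') :=
  .mk ρ u e e' h.none_iff h.some_ren

theorem forall₂_ren_refl (π : List Clos) : List.Forall₂ Clos.Ren π π :=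
  List.forall₂_same.2 fun c _ => .refl c

/-- The machine sees an index only through the entry it retrieves, so renaming code and environment
together changes neither halting nor the length. Keeping the length exact is what lets the index
shifts in the rewriting rules be free of charge. -/
theorem EnvRen.halts_iff {n : ℕ} {t : Term} {ρ : ℕ → ℕ} {e e' π π' : List Clos}
    (he : EnvRen ρ e e') (hπ : List.Forall₂ Clos.Ren π π') :
    Halts n t e π ↔ Halts n (t.rename ρ) e' π' := by
  induction n generalizing t ρ e e' π π' with
  | zero =>
    constructor
    · intro h
      cases h with
      | free h => exact .free ((he.none_iff _).1 h)
      | @dummy i _ _ h =>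
        cases h' : e'[ρ i]? with
        | none => simp [(he.none_iff i).2 h'] at h
        | some c =>
          -- A dummy is related only to itself, so a run that stops on a dummy still does so after
          -- renaming.
          cases he.some_ren i _ _ h h'
          exact .dummy h'
    · intro h
      cases t with
      | var i =>
        simp only [Term.rename] at h
        cases h with
        | free h => exact .free ((he.none_iff _).2 h)
        | dummy h =>
          cases h' : e[i]? with
          | none => simp [(he.none_iff i).1 h'] at h
          | some c =>
            cases he.some_ren i _ _ h' h
            exact .dummy h'
      | _ => cases h
  | succ n ih =>
    constructor
    · intro h
      cases h with
      | @var _ i _ _ u e₁ h hu =>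
        cases h' : e'[ρ i]? with
        | none => simp [(he.none_iff i).2 h'] at h
        | some c =>
          cases he.some_ren i _ _ h h' with
          | refl =>
            refine .var h' ?_
            simpa [Term.rename_id] using (ih (EnvRen.refl e₁) hπ).1 hu
          | mk ρ' _ _ e₁' h0 h1 => exact .var h' ((ih ⟨h0, h1⟩ hπ).1 hu)
      | lam h =>
        cases hπ with
        | cons hc hπ => exact .lam ((ih (he.cons hc) hπ).1 h)
      | app h => exact .app ((ih he (.cons (he.clos _) hπ)).1 h)
      | es h => exact .es ((ih (he.cons (he.clos _)) hπ).1 h)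
    · intro h
      cases t with
      | var i =>
        simp only [Term.rename] at h
        cases h with
        | var h hu =>
          cases h' : e[i]? with
          | none => simp [(he.none_iff i).1 h'] at h
          | some c =>
            generalize hd : Clos.mk _ _ = d at h
            cases he.some_ren i _ _ h' h with
            | refl =>
              subst hd
              refine .var h' ((ih (EnvRen.refl _) hπ).2 ?_)
              simpa [Term.rename_id] using hu
            | mk ρ' u₁ e₁ e₁' h0 h1 =>
              cases hd
              exact .var h' ((ih ⟨h0, h1⟩ hπ).2 hu)
      | lam t =>
        simp only [Term.rename] at h
        cases h with
        | lam h =>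
          cases hπ with
          | cons hc hπ => exact .lam ((ih (he.cons hc) hπ).2 h)
      | app t u =>
        simp only [Term.rename] at h
        cases h with
        | app h => exact .app ((ih he (.cons (he.clos _) hπ)).2 h)
      | es t u =>
        simp only [Term.rename] at h
        cases h with
        | es h => exact .es ((ih (he.cons (he.clos _)) hπ).2 h)

/-! ### Linear head steps shorten the runs of the environment machine -/

/-- The hole of a head context lies in no argument and in no substitution content, so the closures
built while crossing `H` do not depend on the plugged term. The crossing cost `l`, the entries `e₁`
and the stack `π₁` therefore serve for every replacement `s'`. -/
theorem Halts.of_plug_head {H : Ctx} (hH : H.IsHead) {n : ℕ} {s : Term} {e π : List Clos}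
    (h : Halts n (H.plug s) e π) :
    ∃ m l e₁ π₁, n = m + l ∧ e₁.length = H.depth ∧ Halts m s (e₁ ++ e) π₁ ∧
      ∀ m' s', Halts m' s' (e₁ ++ e) π₁ → Halts (m' + l) (H.plug s') e π := by
  induction H generalizing n e π with
  | hole => exact ⟨n, 0, [], π, rfl, rfl, h, fun _ _ h => h⟩
  | lam C ih =>
    cases h with
    | lam h =>
      obtain ⟨m, l, e₁, π₁, rfl, hl, hs, H⟩ := ih hH h
      refine ⟨m, l + 1, e₁ ++ [_], π₁, rfl, by simp [Ctx.depth, hl], by simpa using hs,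
        fun m' s' h' => .lam (H m' s' (by simpa using h'))⟩
  | appL C u ih =>
    cases h with
    | app h =>
      obtain ⟨m, l, e₁, π₁, rfl, hl, hs, H⟩ := ih hH h
      exact ⟨m, l + 1, e₁, π₁, rfl, hl, hs, fun m' s' h' => .app (H m' s' h')⟩
  | esL C u ih =>
    cases h with
    | es h =>
      obtain ⟨m, l, e₁, π₁, rfl, hl, hs, H⟩ := ih hH h
      refine ⟨m, l + 1, e₁ ++ [_], π₁, rfl, by simp [Ctx.depth, hl], by simpa using hs,
        fun m' s' h' => .es (H m' s' (by simpa using h'))⟩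
  | appR t C => simp [Ctx.IsHead, Ctx.level] at hH
  | esR t C => simp [Ctx.IsHead, Ctx.level] at hH

/-- A substitution context never touches the stack, so `e₁` can be chosen before the stack. The `dB`
rule needs this uniformity, since `S` is crossed with one more stack entry before the step than
after it. -/
theorem exists_halts_plug_subst {S : Ctx} (hS : S.IsSubst) (e : List Clos) :
    ∃ e₁ : List Clos, e₁.length = S.depth ∧ ∀ n s π,
      Halts n (S.plug s) e π ↔ ∃ m, n = m + S.depth ∧ Halts m s (e₁ ++ e) π := by
  induction S generalizing e with
  | hole => exact ⟨[], rfl, fun n s π => by simp [Ctx.plug, Ctx.depth]⟩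
  | esL C u ih =>
    obtain ⟨e₁, hl, H⟩ := ih hS (.mk u e :: e)
    refine ⟨e₁ ++ [.mk u e], by simp [Ctx.depth, hl], fun n s π => ⟨fun h => ?_, ?_⟩⟩
    · cases h with
      | es h =>
        obtain ⟨m, rfl, h'⟩ := (H _ _ _).1 h
        exact ⟨m, rfl, by simpa using h'⟩
    · rintro ⟨m, rfl, h⟩
      exact .es ((H _ _ _).2 ⟨m, rfl, by simpa using h⟩)
  | _ => exact hS.elim

theorem Root.halts_lt {r r' : Term} (hr : Root r r') {n : ℕ} {e π : List Clos}
    (h : Halts n r e π) : ∃ m < n, Halts m r' e π := by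
  cases hr with
  | dB S hS t u =>
    obtain ⟨e₁, hl, H⟩ := exists_halts_plug_subst hS e
    cases h with
    | app h =>
      obtain ⟨m, rfl, h'⟩ := (H _ _ _).1 h
      clear h
      cases h' with
      | @lam m _ _ _ _ h =>
        -- The `es` transition replaces the `lam` transition; the initial `app` transition is the
        -- one saved.
        refine ⟨m + 1 + S.depth, by omega, (H _ _ _).2 ⟨m + 1, rfl, .es ?_⟩⟩
        have hc : Clos.Ren (.mk u e) (.mk (u.shift S.depth 0) (e₁ ++ e)) := by
          rw [Term.shift_zero_eq_rename, ← hl]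
          exact (EnvRen.append e₁ e).clos u
        have := ((EnvRen.refl (e₁ ++ e)).cons hc).halts_iff (forall₂_ren_refl π) |>.1 h
        rwa [liftRen_id, Term.rename_id] at this
  | ls H hH t =>
    cases h with
    | es h =>
      obtain ⟨m, l, e₁, π₁, rfl, hl, hs, Hs⟩ := h.of_plug_head hH
      have hx : (e₁ ++ Clos.mk t e :: e)[H.depth]? = some (.mk t e) := by simp [← hl]
      generalize he : e₁ ++ Clos.mk t e :: e = e₂ at hs hx Hs
      generalize hi : H.depth = i at *
      cases hs with
      | free h => simp [h] at hx
      | dummy h => simp [h] at hx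
      | @var m _ _ _ u e' h hu =>
        rw [h] at hx
        cases hx
        -- The lookup is saved. The copied content now runs below `H.depth + 1` additional entries,
        -- which its shift skips.
        refine ⟨m + l + 1, by omega, .es (Hs _ _ ?_)⟩
        have := (EnvRen.append (e₁ ++ [.mk t e]) e).halts_iff (forall₂_ren_refl π₁) |>.1 hu
        rw [← Term.shift_zero_eq_rename] at this
        simpa [hl, he] using this
  | gc t u =>
    cases h with
    | @es m _ _ _ _ h =>
      refine ⟨m, by omega, ?_⟩
      rw [Term.shift_zero_eq_rename] at h
      exact ((EnvRen.append [.mk u e] e).halts_iff (forall₂_ren_refl π)).2 h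

theorem LHE.halts_lt {t u : Term} (h : LHE t u) {n : ℕ} {e π : List Clos}
    (ht : Halts n t e π) : ∃ m < n, Halts m u e π := by
  cases h with
  | ctx H hH hr =>
    obtain ⟨m, l, e₁, π₁, rfl, -, hs, Hs⟩ := ht.of_plug_head hH
    obtain ⟨m', hm, h'⟩ := hr.halts_lt hs
    exact ⟨m' + l, by omega, Hs _ _ h'⟩

/-- The tail of an infinite reduction is again infinite, so a run would yield an infinite descent of
lengths. -/
theorem Divergent.not_halts {t : Term} (ht : Divergent t) (n : ℕ) (e π : List Clos) :
    ¬ Halts n t e π := by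
  induction n using Nat.strong_induction_on generalizing t with
  | _ n ih =>
    intro h
    obtain ⟨f, rfl, hf⟩ := ht
    obtain ⟨m, hm, h'⟩ := (hf 0).halts_lt h
    exact ih m hm ⟨fun i => f (i + 1), rfl, fun i => hf (i + 1)⟩ h'

/-! ### Reversibility of the λ-IAM -/

def Dir.flip : Dir → Dir
  | down => up
  | up => down

def State.flip (s : State) : State := ⟨s.term, s.ctx, s.log, s.tape, s.dir.flip⟩

/-- The rules are paired so that exchanging the two directions turns each one into the inverse of
another. -/
theorem Step.flip {s s' : State} (h : Step s s') : Step s'.flip s.flip := by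
  cases h <;> simp only [State.flip, Dir.flip] <;> constructor

theorem Reaches.flip {s s' : State} (h : Reaches s s') : Reaches s'.flip s.flip := by
  induction h with
  | refl => exact .refl
  | tail _ h ih => exact .head h.flip ih

theorem Reaches.of_reaches_final {s a b : State} (h1 : Reaches s a) (h2 : Reaches s b)
    (hb : b.Final) : Reaches a b := by
  induction h1 with
  | refl => exact h2
  | tail _ h ih =>
    rcases Relation.ReflTransGen.cases_head ih with rfl | ⟨c, h', h3⟩
    · exact (hb _ h).elim
    · exact Step.deterministic h' h ▸ h3

/-! ### The λ-IAM follows the environment machine -/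

theorem Ctx.comp_assoc (A B C : Ctx) : (A.comp B).comp C = A.comp (B.comp C) := by
  induction A <;> simp_all [Ctx.comp]

theorem Ctx.plug_comp (A B : Ctx) (t : Term) : (A.comp B).plug t = A.plug (B.plug t) := by
  induction A <;> simp_all [Ctx.comp, Ctx.plug]

theorem Ctx.level_comp (A B : Ctx) : (A.comp B).level = A.level + B.level := by
  induction A <;> simp_all [Ctx.comp, Ctx.level] <;> omega

/-- From the position `(s, C)` with log `L`, a token that moves up with a logged position below `i`
symbols `p` finds the argument `u` of `t u`, at the context `C'` with log `L'`. -/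
def Finds (s : Term) (C : Ctx) (L : List LPos) (i : ℕ) (t u : Term) (C' : Ctx) (L' : List LPos) :
    Prop :=
  ∀ l T, Reaches ⟨s, C, L, List.replicate i p ++ pos l :: T, up⟩
    ⟨u, C'.comp (.appR t .hole), l :: L', T, down⟩

/-- The environment `e` describes the binders of the context `C` of `s`, for the log `L`. -/
inductive Models : Term → Ctx → List LPos → List Clos → Prop
  | hole (t : Term) : Models t .hole [] []
  | appL {t u C L e} (h : Models (.app t u) C L e) : Models t (C.comp (.appL .hole u)) L e
  | appR {t u C L e} (l : LPos) (h : Models (.app t u) C L e) :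
      Models u (C.comp (.appR t .hole)) (l :: L) e
  | esL {t u C L e} (h : Models (.es t u) C L e) :
      Models t (C.comp (.esL .hole u)) L (.mk u e :: e)
  | esR {t u C L e} (l : LPos) (h : Models (.es t u) C L e) :
      Models u (C.comp (.esR t .hole)) (l :: L) e
  | lamDummy {t C L e} (h : Models (.lam t) C L e) :
      Models t (C.comp (.lam .hole)) L (.dummy :: e)
  | lam {t C L e t' u C' L' e'} (h : Models (.lam t) C L e) (h' : Models (.app t' u) C' L' e')
      (hf : Finds (.lam t) C L 0 t' u C' L') :
      Models t (C.comp (.lam .hole)) L (.mk u e' :: e)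

/-- The binder of index `i` of the context `C` of `s` with log `L` gives access to `(u, e)`. -/
def Binds (s : Term) (C : Ctx) (L : List LPos) (i : ℕ) (u : Term) (e : List Clos) : Prop :=
  ∃ (C₁ D : Ctx) (Lm L₁ : List LPos), L = Lm ++ L₁ ∧ Lm.length = D.level ∧ D.depth = i ∧
    ((C = C₁.comp (.lam D) ∧ ∃ t' C' L', Models (.app t' u) C' L' e ∧
        Finds (.lam (D.plug s)) C₁ L₁ 0 t' u C' L') ∨
      (C = C₁.comp (.esL D u) ∧ Models (.es (D.plug s) u) C₁ L₁ e))

theorem Binds.comp {s s' : Term} {C : Ctx} {L : List LPos} {i : ℕ} {u : Term} {e : List Clos}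
    (X : Ctx) (M : List LPos) (hM : M.length = X.level) (h : Binds (X.plug s) C L i u e)
    (hs : s' = s) : Binds s' (C.comp X) (M ++ L) (i + X.depth) u e := by
  subst hs
  obtain ⟨C₁, D, Lm, L₁, rfl, hL, rfl, h⟩ := h
  refine ⟨C₁, D.comp X, M ++ Lm, L₁, by simp, by simp [Ctx.level_comp, hL, hM, add_comm],
    by simp [Ctx.depth_comp], ?_⟩
  rcases h with ⟨rfl, h⟩ | ⟨rfl, h⟩
  · exact .inl ⟨by simp [Ctx.comp_assoc, Ctx.comp], by simpa [Ctx.plug_comp] using h⟩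
  · exact .inr ⟨by simp [Ctx.comp_assoc, Ctx.comp], by simpa [Ctx.plug_comp] using h⟩

/-- Walking outwards to the binder, each frame crossed joins the inner context `D`. Entering an
argument or a substitution content raises the level and puts exactly one entry on the log, so the
log prefix has the length that the variable transitions require. -/
theorem Models.binds {s : Term} {C : Ctx} {L : List LPos} {e : List Clos} (h : Models s C L e)
    {i : ℕ} {u : Term} {e' : List Clos} (hi : e[i]? = some (.mk u e')) : Binds s C L i u e' := by
  induction h generalizing i with
  | hole t => simp at hi
  | @appL t u C L e h ih => exact (ih hi).comp (.appL .hole u) [] rfl rfl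
  | @appR t u C L e l h ih => exact (ih hi).comp (.appR t .hole) [l] rfl rfl
  | @esR t u C L e l h ih => exact (ih hi).comp (.esR t .hole) [l] rfl rfl
  | @esL t u C L e h ih =>
    cases i with
    | zero =>
      simp at hi
      obtain ⟨rfl, rfl⟩ := hi
      exact ⟨C, .hole, [], L, rfl, rfl, rfl, .inr ⟨rfl, h⟩⟩
    | succ i => exact (ih (by simpa using hi)).comp (.esL .hole u) [] rfl rfl
  | @lamDummy t C L e h ih =>
    cases i with
    | zero => simp at hi
    | succ i => exact (ih (by simpa using hi)).comp (.lam .hole) [] rfl rfl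
  | @lam t C L e t' u C' L' e' h h' hf ih =>
    cases i with
    | zero =>
      simp at hi
      obtain ⟨rfl, rfl⟩ := hi
      exact ⟨C, .hole, [], L, rfl, rfl, rfl, .inl ⟨rfl, _, _, _, h', hf⟩⟩
    | succ i => exact (ih (by simpa using hi)).comp (.lam .hole) [] rfl rfl

/-- The stack `π` describes the arguments that the position `(s, C)` with log `L` has been
given. -/
def StackModels (s : Term) (C : Ctx) (L : List LPos) (π : List Clos) : Prop :=
  ∀ (i : ℕ) (u : Term) (e : List Clos), π[i]? = some (.mk u e) →
    ∃ t C' L', Models (.app t u) C' L' e ∧ Finds s C L i t u C' L'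

/-- An upward path that works for every tape forwards all argument queries unchanged. -/
theorem StackModels.of_reaches {s s' : Term} {C C' : Ctx} {L L' : List LPos} {π : List Clos}
    (h : StackModels s C L π)
    (hr : ∀ T, Reaches ⟨s', C', L', T, up⟩ ⟨s, C, L, T, up⟩) : StackModels s' C' L' π := by
  intro i u e hi
  obtain ⟨t, C₂, L₂, hm, hf⟩ := h i u e hi
  exact ⟨t, C₂, L₂, hm, fun l T => (hr _).trans (hf l T)⟩

/-- A variable whose index is bound to a closure leads the token to the code of that closure. -/
theorem Binds.jump {i : ℕ} {C : Ctx} {L : List LPos} {u : Term} {e : List Clos}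
    (h : Binds (.var i) C L i u e) :
    ∃ C' L', Models u C' L' e ∧ (∀ T, Relation.TransGen Step ⟨.var i, C, L, T, down⟩
      ⟨u, C', L', T, down⟩) := by
  obtain ⟨C₁, D, Lm, L₁, rfl, hL, rfl, h⟩ := h
  obtain ⟨Ln, rfl⟩ : ∃ Ln : Fin D.level → LPos, Lm = List.ofFn Ln := by
    rw [← hL]
    exact ⟨Lm.get, (List.ofFn_get Lm).symm⟩
  rcases h with ⟨rfl, t', C', L', hm, hf⟩ | ⟨rfl, hm⟩
  · exact ⟨_, _, hm.appR (lamPos D Ln), fun T => .head' (.var C₁ D Ln L₁ T) (hf _ _)⟩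
  · exact ⟨_, _, hm.esR (esPos D u Ln), fun T => .single (.var2 C₁ D u Ln L₁ T)⟩

theorem Reaches.acc_final {a b : State} (h : Reaches a b) (hb : b.Final) :
    Acc (Function.swap Step) a := by
  induction h using Relation.ReflTransGen.head_induction_on with
  | refl => exact ⟨_, fun c h => (hb c h).elim⟩
  | head h _ ih => exact ⟨_, fun c h' => Step.deterministic h h' ▸ ih⟩

/-- The induction is over nonempty sequences of λ-IAM steps, because one lookup of a λ-bound
variable may require a long search for the argument. -/
theorem Models.exists_halts {q F : State} (hq : Acc (Relation.TransGen (Function.swap Step)) q)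
    (hF : F.Final) (hF' : ∀ u C L, F ≠ ⟨.lam u, C, L, [], down⟩) (hqF : Reaches q F)
    {s : Term} {C : Ctx} {L : List LPos} {e π : List Clos}
    (hs : q = ⟨s, C, L, List.replicate π.length p, down⟩) (he : Models s C L e)
    (hπ : StackModels s C L π) : ∃ n, Halts n s e π := by
  induction hq generalizing s C L e π with
  | intro q _ ih =>
    subst hs
    have next : ∀ {s' : Term} {C' : Ctx} {L' : List LPos} {e' π' : List Clos},
        Relation.TransGen Step ⟨s, C, L, List.replicate π.length p, down⟩
          ⟨s', C', L', List.replicate π'.length p, down⟩ →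
        Models s' C' L' e' → StackModels s' C' L' π' → ∃ n, Halts n s' e' π' := by
      intro s' C' L' e' π' hst he' hπ'
      exact ih _ (Relation.transGen_swap.2 hst)
        (Reaches.of_reaches_final hst.to_reflTransGen hqF hF) rfl he' hπ'
    cases s with
    | var i =>
      cases hi : e[i]? with
      | none => exact ⟨0, .free hi⟩
      | some c =>
        cases c with
        | dummy => exact ⟨0, .dummy hi⟩
        | mk u e' =>
          obtain ⟨C', L', hm, hj⟩ := (he.binds hi).jump
          obtain ⟨n, hn⟩ := next (hj _) hm
            -- Reversing the jump brings queries from the retrieved code back to the variable, where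
            -- the stack is already described.
            (hπ.of_reaches fun T => Reaches.flip (hj T).to_reflTransGen)
          exact ⟨n + 1, .var hi hn⟩
    | lam t =>
      cases π with
      | nil =>
        -- With no argument left the λ-IAM is stuck on a failure state, so it cannot reach `F`.
        rcases Relation.ReflTransGen.cases_head hqF with h | ⟨c, h, -⟩
        · exact (hF' _ _ _ h.symm).elim
        · exact (final_fail t C L c h).elim
      | cons c π =>
        have hst : StackModels t (C.comp (.lam .hole)) L π := by
          intro i u e₁ hi
          obtain ⟨t', C₂, L₂, hm, hf⟩ := hπ (i + 1) u e₁ hi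
          -- Leaving the abstraction upwards adds one `p`, so argument `i` of the body is argument
          -- `i + 1` of the abstraction.
          exact ⟨t', C₂, L₂, hm, fun l T => .head (.lamUp ..) (hf l T)⟩
        have hm : Models t (C.comp (.lam .hole)) L (c :: e) := by
          cases c with
          | dummy => exact he.lamDummy
          | mk u e' =>
            obtain ⟨t', C', L', hm, hf⟩ := hπ 0 u e' rfl
            exact he.lam hm hf
        obtain ⟨n, hn⟩ := next (.single (.lam ..)) hm hst
        exact ⟨n + 1, .lam hn⟩
    | app t u =>
      have hst : StackModels t (C.comp (.appL .hole u)) L (.mk u e :: π) := by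
        intro i u' e₁ hi
        cases i with
        | zero =>
          simp at hi
          obtain ⟨rfl, rfl⟩ := hi
          exact ⟨t, C, L, he, fun l T => .single (.arg ..)⟩
        | succ i =>
          obtain ⟨t', C₂, L₂, hm, hf⟩ := hπ i u' e₁ hi
          exact ⟨t', C₂, L₂, hm, fun l T => .head (.appUp ..) (hf l T)⟩
      obtain ⟨n, hn⟩ := next (.single (.app ..)) he.appL hst
      exact ⟨n + 1, .app hn⟩
    | es t u =>
      obtain ⟨n, hn⟩ := next (.single (.es ..)) he.esL
        (hπ.of_reaches fun T => .single (.esUp ..))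
      exact ⟨n + 1, .es hn⟩

theorem exists_halts_of_reaches {t : Term} {k : ℕ} {F : State} (h : Reaches (initState t k) F)
    (hF : F.Final) (hF' : ∀ u C L, F ≠ ⟨.lam u, C, L, [], down⟩) :
    ∃ n, Halts n t [] (List.replicate k .dummy) :=
  Models.exists_halts (h.acc_final hF).transGen hF hF' h (by simp [initState]) (.hole t)
    -- The initial stack holds only dummies, so no argument has to be located.
    fun i u e hi => by simp [List.getElem?_replicate] at hi

end LSC

theorem mainTheorem7 (t : LSC.Term) (ht : LSC.Divergent t) :
    ¬ ∃ k : ℕ, (LSC.sem t k).IsSuccess := by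
  rintro ⟨k, hk⟩
  suffices h : ∃ n, LSC.Halts n t [] (List.replicate k .dummy) from
    h.elim fun n hn => ht.not_halts n _ _ hn
  have hy := LSC.sem_eq_iff.1 (rfl : LSC.sem t k = LSC.sem t k)
  generalize LSC.sem t k = o at hk hy
  cases o with
  | bound h j =>
    obtain ⟨l, hr⟩ := hy
    exact LSC.exists_halts_of_reaches hr (LSC.final_bound _ _ _) (by simp)
  | openVar x h =>
    obtain ⟨C, L, hr⟩ := hy
    exact LSC.exists_halts_of_reaches hr (LSC.final_openVar _ _ _ _) (by simp)
  | fail => exact hk.elim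
  | bot => exact hk.elim
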